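/- Let $G$ be a countably infinite discrete group acting continuously on a compact metrizable space $X$, and let $M_G(X)$ be the set of $G$-invariant regular Borel probability measures on $X$. For a closed set $F\subset X$ and an open set $O\subset X$ write $F\prec O$ if there are finitely many open sets $U_1,\dots,U_J$ covering $F$ and $s_1,\dots,s_J\in G$ such that the sets $s_1U_1,\dots,s_JU_J$ are pairwise disjoint subsets of $O$. For open sets $A,B\subset X$ write $A\prec B$ if $F\prec B$ for every closed set $F\subset A$. For $n,m\in\mathbb{N}^+$ write $nA\prec mB$ if for all closed sets $F_1,\dots,F_n\subset A$ there are, for each $i\in\{1,\dots,n\}$, open sets $U^{(i)}_1,\dots,U^{(i)}_{J_i}$ covering $F_i$, elements $s^{(i)}_1,\dots,s^{(i)}_{J_i}\in G$ and indices $k^{(i)}_1,\dots,k^{(i)}_{J_i}\in\{1,\dots,m\}$ such that the sets $s^{(i)}_jU^{(i)}_j\times\{k^{(i)}_j\}$ ($1\le i\le n$, $1\le j\le J_i$) are pairwise disjoint subsets of $B\times\{1,\dots,m\}$. Suppose that $G$ is amenable or that the action is minimal (every orbit is dense). Then the following are equivalent: (i) For all open sets $A,B\subset X$ such that $\mu(B)>0$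 for all $\mu\in M_G(X)$, if $(n+1)A\prec nB$ for some $n\in\mathbb{N}^+$, then $A\prec B$. (ii) The action has dynamical comparison: $V\prec O$ for all open sets $V,O\subset X$ with $O\neq\emptyset$ such that $\mu(V)<\mu(O)$ for every $\mu\in M_G(X)$. -/

import Mathlib

open scoped Pointwise
open MeasureTheory

namespace DynComparison

/-- The space of all bounded real-valued functions on `G`. -/
def boundedFunctions (G : Type*) : Submodule ℝ (G → ℝ) where
  carrier := {f | ∃ C : ℝ, ∀ h, |f h| ≤ C}
  zero_mem' := ⟨0, fun h => by simp⟩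
  add_mem' := by
    rintro f f' ⟨C, hC⟩ ⟨C', hC'⟩
    exact ⟨C + C', fun h => (abs_add_le (f h) (f' h)).trans (add_le_add (hC h) (hC' h))⟩
  smul_mem' := by
    rintro c f ⟨C, hC⟩
    refine ⟨|c| * C, fun h => ?_⟩
    simpa [abs_mul] using mul_le_mul_of_nonneg_left (hC h) (abs_nonneg c)

/-- The left translate `h ↦ f (g⁻¹ * h)` of a bounded function `f` on the group `G`. -/
def leftTranslate {G : Type*} [Group G] (g : G) (f : boundedFunctions G) : boundedFunctions G :=
  ⟨fun h => (f : G → ℝ) (g⁻¹ * h), by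
    obtain ⟨C, hC⟩ := f.2
    exact ⟨C, fun h => hC (g⁻¹ * h)⟩⟩

/-- A discrete group `G` is amenable if there is a left-invariant mean on the space of bounded
real-valued functions on `G`. -/
def IsAmenable (G : Type*) [Group G] : Prop :=
  ∃ m : boundedFunctions G →ₗ[ℝ] ℝ,
    (∀ f : boundedFunctions G, (∀ h, 0 ≤ (f : G → ℝ) h) → 0 ≤ m f) ∧
    (∀ f : boundedFunctions G, (∀ h, (f : G → ℝ) h = 1) → m f = 1) ∧
    (∀ (g : G) (f : boundedFunctions G), m (leftTranslate g f) = m f)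

/-- The set `M_G(X)` of all `G`-invariant regular Borel probability measures on `X`. -/
def invariantMeasures (G X : Type*) [Group G] [MulAction G X] [TopologicalSpace X]
    [MeasurableSpace X] [BorelSpace X] : Set (Measure X) :=
  {μ | IsProbabilityMeasure μ ∧ μ.Regular ∧ SMulInvariantMeasure G X μ}

/-- `F ≺ O` for a closed set `F` and an open set `O`: there are finitely many open sets `U j`
covering `F` and group elements `s j` such that the images `s j • U j` are pairwise disjoint
subsets of `O`. -/
def ClosedSubequiv (G : Type*) {X : Type*} [Group G] [MulAction G X] [TopologicalSpace X]
    (F O : Set X) : Prop :=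
  ∃ (J : ℕ) (U : Fin J → Set X) (s : Fin J → G),
    (∀ j, IsOpen (U j)) ∧
    F ⊆ ⋃ j, U j ∧
    (∀ j, s j • U j ⊆ O) ∧
    Pairwise fun i j => Disjoint (s i • U i) (s j • U j)

/-- `A ≺ B` for open sets `A` and `B`: every closed subset `F` of `A` satisfies `F ≺ B`. -/
def OpenSubequiv (G : Type*) {X : Type*} [Group G] [MulAction G X] [TopologicalSpace X]
    (A B : Set X) : Prop :=
  ∀ F : Set X, IsClosed F → F ⊆ A → ClosedSubequiv G F B

/-- `⨆ i, O i × {i} ≺ ⨆ l, V l × {l}` for two finite sequences of open sets. The pair `⟨i, j⟩`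
indexes the `j`-th member of the open cover of the closed set `F i ⊆ O i`; it is moved by the
group element `s ⟨i, j⟩` into the level `k ⟨i, j⟩`. -/
def SeqSubequiv (G : Type*) {X : Type*} [Group G] [MulAction G X] [TopologicalSpace X]
    {n m : ℕ} (O : Fin n → Set X) (V : Fin m → Set X) : Prop :=
  ∀ F : Fin n → Set X, (∀ i, IsClosed (F i)) → (∀ i, F i ⊆ O i) →
    ∃ (J : Fin n → ℕ) (U : (Σ i, Fin (J i)) → Set X) (s : (Σ i, Fin (J i)) → G)
      (k : (Σ i, Fin (J i)) → Fin m),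
      (∀ p, IsOpen (U p)) ∧
      (∀ i, F i ⊆ ⋃ j, U ⟨i, j⟩) ∧
      (Pairwise fun p q => Disjoint ((s p • U p) ×ˢ {k p}) ((s q • U q) ×ˢ {k q})) ∧
      (⋃ p, (s p • U p) ×ˢ {k p}) ⊆ ⋃ l, V l ×ˢ {l}

/-- `n A ≺ m B`: the relation `SeqSubequiv` between `n` copies of `A` and `m` copies of `B`. -/
def MulSubequiv (G : Type*) {X : Type*} [Group G] [MulAction G X] [TopologicalSpace X]
    (n : ℕ) (A : Set X) (m : ℕ) (B : Set X) : Prop :=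
  SeqSubequiv G (fun _ : Fin n => A) (fun _ : Fin m => B)

/-- Dynamical comparison: `V ≺ O` for all open sets `V` and `O`, with `O` non-empty, such that
`μ V < μ O` for every `G`-invariant regular Borel probability measure `μ`. Non-emptiness of `O`
follows from the other condition unless there is no such measure at all. -/
def HasDynamicalComparison (G X : Type*) [Group G] [MulAction G X] [TopologicalSpace X]
    [MeasurableSpace X] [BorelSpace X] : Prop :=
  ∀ V O : Set X, IsOpen V → IsOpen O → O.Nonempty →
    (∀ μ ∈ invariantMeasures G X, μ V < μ O) → OpenSubequiv G V O

end DynComparison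

/-!
Dynamical comparison implies the condition on multiples by an estimate: a relation
`(n + 1) A ≺ n B` moves disjoint pieces into `n` copies of `B`, so
`(n + 1) μ A ≤ n μ B` for each invariant measure `μ`, and hence `μ A < μ B` when `μ B > 0`.

For the converse let `μ V < μ O` for all invariant `μ`, and let `F ⊆ V` be closed. It suffices to
find `n > 0` with `(n + 1) A ≺ n O` for some open `A` with `F ⊆ A ⊆ closure A ⊆ V`, since the
condition on multiples then gives `A ≺ O`. This is
`exists_mulSubequiv_of_measure_lt`, whose proof turns states into measures.

* Finite families of open sets form a preordered commutative monoid `OpenFamily G X` under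
  `FamilySubequiv`, a relation stronger than `SeqSubequiv`. Leaving closed subsets out of the
  relation makes its transitivity immediate, and the weaker relation is recovered by compactness.
* Every orbit meets `O`. This is clear for a minimal action. For an amenable group, the mean time
  spent in open sets by an orbit that avoids `O` would define an invariant measure vanishing on `O`
  (`exists_smul_mem_of_isAmenable`). Hence `O` is an order unit of `OpenFamily G X`.
* If `(n + 1) A ≤ n O` fails for all `n`, then `exists_state` gives an additive monotone `f` with
  `f O = 1 ≤ f A`. It is obtained from the Riesz extension theorem in the real vector space freely
  generated by the monoid, applied to the cone `gapCone`.
* On open sets `f` is subadditive, superadditive on disjoint pairs and invariant. Its infima over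
  the open neighbourhoods of compact sets form a content, and
  `OpenContent.exists_invariantMeasure` produces from it an invariant probability measure `μ` and
  a constant `c > 0` with `c μ O ≤ f O = 1 ≤ f A ≤ c μ V`, against `μ V < μ O`.
-/

namespace DynComparison

/-! ### States on preordered commutative monoids -/

section State

variable {M : Type*} [AddCommMonoid M]

/-- The sum in `M` of a formal combination of elements of `M` with natural coefficients. -/
noncomputable def evalSum (M : Type*) [AddCommMonoid M] : (M →₀ ℕ) →+ M :=
  Finsupp.liftAddHom fun m => (multiplesHom M) m

lemma evalSum_single (m : M) (k : ℕ) : evalSum M (Finsupp.single m k) = k • m := by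
  simp [evalSum]

variable [Preorder M]

/-- `IsGap u x z` holds for those differences `z = p - q` of formal combinations on which each state
`f` with `f u ≤ f x` has to be nonnegative: the combination `p` dominates `q` up to exchanging
copies of `x` for copies of `u`. -/
def IsGap (u x : M) (z : M →₀ ℝ) : Prop :=
  ∃ (p q : M →₀ ℕ) (t : ℕ), (∀ m, z m = (p m : ℝ) - q m) ∧
    evalSum M q + t • x ≤ evalSum M p + t • u

lemma IsGap.zero (u x : M) : IsGap u x 0 := ⟨0, 0, 0, by simp, by simp⟩

lemma isGap_single_sub_single {u x a b : M} (h : b ≤ a) :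
    IsGap u x (Finsupp.single a 1 - Finsupp.single b 1) := by
  classical
  refine ⟨Finsupp.single a 1, Finsupp.single b 1, 0, fun m => ?_, ?_⟩
  · simp [Finsupp.single_apply]
  · simpa [evalSum_single] using h

variable [IsOrderedAddMonoid M]

lemma add_nsmul_le_of_le {a b c : M} (h : c + a ≤ c + b) (j : ℕ) : c + j • a ≤ c + j • b := by
  induction j with
  | zero => simp
  | succ j ih =>
    calc c + (j + 1) • a = (c + j • a) + a := by rw [succ_nsmul, add_assoc]
      _ ≤ (c + j • b) + a := by gcongr
      _ = (c + a) + j • b := by abel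
      _ ≤ (c + b) + j • b := by gcongr
      _ = c + (j + 1) • b := by rw [succ_nsmul]; abel

/-- A comparison after adding `c` on both sides gains one copy on the left at each iteration, which
eventually absorbs the multiple `C • u` that bounds `c`. -/
lemma exists_succ_nsmul_le_of_add_le (hpos : ∀ a : M, 0 ≤ a) {u x c : M} {C s : ℕ}
    (hc : c ≤ C • u) (h : c + (s + 1) • x ≤ c + s • u) :
    ∃ n : ℕ, (n + 1) • x ≤ n • u := by
  refine ⟨C + (C + 1) * s, ?_⟩
  have h1 := add_nsmul_le_of_le h (C + 1)
  calc (C + (C + 1) * s + 1) • x = 0 + (C + 1) • (s + 1) • x := by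
        rw [zero_add, ← mul_nsmul']; congr 1; ring
    _ ≤ c + (C + 1) • (s + 1) • x := by gcongr; exact hpos c
    _ ≤ c + (C + 1) • s • u := h1
    _ ≤ C • u + (C + 1) • s • u := by gcongr
    _ = (C + (C + 1) * s) • u := by rw [← mul_nsmul', ← add_nsmul]

lemma evalSum_mono (hpos : ∀ a : M, 0 ≤ a) {p q : M →₀ ℕ} (h : p ≤ q) :
    evalSum M p ≤ evalSum M q := by
  obtain ⟨r, rfl⟩ := exists_add_of_le h
  rw [map_add]
  exact le_add_of_nonneg_right (hpos _)

lemma IsGap.add {u x : M} {z z' : M →₀ ℝ} (h : IsGap u x z) (h' : IsGap u x z') :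
    IsGap u x (z + z') := by
  obtain ⟨p, q, t, hz, hle⟩ := h
  obtain ⟨p', q', t', hz', hle'⟩ := h'
  refine ⟨p + p', q + q', t + t', fun m => ?_, ?_⟩
  · simp only [Finsupp.add_apply, hz, hz']; push_cast; ring
  · calc evalSum M (q + q') + (t + t') • x
        = (evalSum M q + t • x) + (evalSum M q' + t' • x) := by rw [map_add, add_nsmul]; abel
      _ ≤ (evalSum M p + t • u) + (evalSum M p' + t' • u) := by gcongr
      _ = evalSum M (p + p') + (t + t') • u := by rw [map_add, add_nsmul]; abel

lemma IsGap.nsmul {u x : M} {z : M →₀ ℝ} (h : IsGap u x z) (N : ℕ) : IsGap u x ((N : ℝ) • z) := by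
  induction N with
  | zero => simpa using IsGap.zero u x
  | succ N ih =>
    rw [show ((N + 1 : ℕ) : ℝ) • z = (N : ℝ) • z + z by push_cast; rw [add_smul, one_smul]]
    exact ih.add h

/-- The cone of real combinations whose positive integer multiples all lie within a bounded distance
of a gap. Rounding to integers in this way avoids solving linear systems over the rationals. -/
noncomputable def gapCone (u x : M) : PointedCone ℝ (M →₀ ℝ) where
  carrier := {y | ∃ e : M →₀ ℕ, ∀ N : ℕ, ∃ z, IsGap u x z ∧ ∀ m, |N * y m - z m| ≤ e m}
  zero_mem' := ⟨0, fun _ => ⟨0, IsGap.zero u x, by simp⟩⟩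
  add_mem' := by
    rintro y y' ⟨e, he⟩ ⟨e', he'⟩
    refine ⟨e + e', fun N => ?_⟩
    obtain ⟨z, hz, h⟩ := he N
    obtain ⟨z', hz', h'⟩ := he' N
    refine ⟨z + z', hz.add hz', fun m => ?_⟩
    have := (abs_add_le (N * y m - z m) (N * y' m - z' m)).trans (add_le_add (h m) (h' m))
    simp only [Finsupp.add_apply]
    push_cast
    exact le_of_eq_of_le (congrArg abs (by ring)) this
  smul_mem' := by
    rintro ⟨c, hc⟩ y ⟨e, he⟩
    refine ⟨e + y.mapRange (fun r => ⌈|r|⌉₊) (by simp), fun N => ?_⟩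
    obtain ⟨z, hz, h⟩ := he ⌊N * c⌋₊
    refine ⟨z, hz, fun m => ?_⟩
    have h1 : |(N * c - ⌊N * c⌋₊) * y m| ≤ ⌈|y m|⌉₊ := by
      have h2 : |N * c - ⌊N * c⌋₊| ≤ 1 := by
        have h3 := Nat.floor_le (show 0 ≤ N * c by positivity)
        have h4 := Nat.lt_floor_add_one (N * c)
        rw [abs_le]; constructor <;> linarith
      rw [abs_mul]
      calc _ ≤ 1 * |y m| := by gcongr
        _ ≤ _ := by rw [one_mul]; exact Nat.le_ceil _
    have := (abs_add_le _ _).trans (add_le_add (h m) h1)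
    simp only [Finsupp.add_apply, Finsupp.mapRange_apply]
    push_cast
    refine le_of_eq_of_le (congrArg abs ?_) this
    change N * (c * y m) - z m = _
    ring

lemma IsGap.mem_gapCone {u x : M} {z : M →₀ ℝ} (h : IsGap u x z) : z ∈ gapCone u x :=
  ⟨0, fun N => ⟨_, h.nsmul N, by simp⟩⟩

/-- A negative multiple of the order unit `u` in the cone would yield `(n + 1) • x ≤ n • u`. -/
lemma nonneg_of_smul_single_mem_gapCone (hpos : ∀ a : M, 0 ≤ a) {u x : M}
    (hu : ∀ a : M, ∃ K : ℕ, a ≤ K • u) (hx : ∀ n : ℕ, ¬ (n + 1) • x ≤ n • u) {c : ℝ}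
    (hc : c • Finsupp.single u (1 : ℝ) ∈ gapCone u x) : 0 ≤ c := by
  classical
  by_contra! hneg
  obtain ⟨e, he⟩ := hc
  obtain ⟨C, hC⟩ := hu (evalSum M e)
  obtain ⟨N, hN⟩ := exists_nat_ge ((C + 1) / (-c))
  rw [div_le_iff₀ (by linarith)] at hN
  obtain ⟨z, ⟨p, q, t, hz, hle⟩, h⟩ := he N
  have hpq : p + Finsupp.single u (C + 1) ≤ q + e := by
    intro m
    have h1 := (abs_le.1 (h m)).1
    rw [hz] at h1
    simp only [Finsupp.add_apply]
    rw [← Nat.cast_le (α := ℝ)]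
    push_cast
    by_cases hm : u = m
    · subst hm
      simp at h1 ⊢
      nlinarith
    · simp [hm] at h1 ⊢
      linarith
  have h1 : (evalSum M p + C • u) + u + t • x ≤ (evalSum M p + C • u) + t • u :=
    calc (evalSum M p + C • u) + u + t • x
        = evalSum M (p + Finsupp.single u (C + 1)) + t • x := by
          rw [map_add, evalSum_single, succ_nsmul]; abel
      _ ≤ evalSum M (q + e) + t • x := by gcongr; exact evalSum_mono hpos hpq
      _ = (evalSum M q + t • x) + evalSum M e := by rw [map_add]; abel
      _ ≤ (evalSum M p + t • u) + C • u := by gcongr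
      _ = (evalSum M p + C • u) + t • u := by abel
  generalize evalSum M p + C • u = a at h1
  rcases t with _ | s
  · -- Here `a` absorbs any multiple of `u`, hence also `x`.
    obtain ⟨K, hK⟩ := hu x
    obtain ⟨D, hD⟩ := hu a
    have h2 : a + u ≤ a + 0 := by simpa using h1
    have h3 := add_nsmul_le_of_le h2 K
    obtain ⟨n, hn⟩ := exists_succ_nsmul_le_of_add_le hpos (u := u) (x := x) (s := 0) hD (by
      calc a + (0 + 1) • x = a + x := by simp
        _ ≤ a + K • u := by gcongr
        _ ≤ a + 0 • u := by simpa using h3)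
    exact hx n hn
  · obtain ⟨D, hD⟩ := hu (a + u)
    obtain ⟨n, hn⟩ := exists_succ_nsmul_le_of_add_le hpos (x := x) (s := s) hD (by
      refine h1.trans_eq ?_
      rw [succ_nsmul]; abel)
    exact hx n hn

lemma exists_smul_single_add_mem_gapCone (hpos : ∀ a : M, 0 ≤ a) {u x : M}
    (hu : ∀ a : M, ∃ K : ℕ, a ≤ K • u) (y : M →₀ ℝ) :
    ∃ d : ℝ, d • Finsupp.single u (1 : ℝ) + y ∈ gapCone u x := by
  classical
  have hsmul : ∀ (c : ℝ) {y : M →₀ ℝ}, 0 ≤ c → y ∈ gapCone u x → c • y ∈ gapCone u x :=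
    fun c y hc hy => (gapCone u x).smul_mem hc hy
  induction y using Finsupp.induction_linear with
  | zero => exact ⟨0, by simp⟩
  | add y y' hy hy' =>
    obtain ⟨d, hd⟩ := hy
    obtain ⟨d', hd'⟩ := hy'
    refine ⟨d + d', ?_⟩
    convert add_mem hd hd' using 1
    rw [add_smul]; abel
  | single m c =>
    rcases le_total 0 c with hc | hc
    · refine ⟨0, ?_⟩
      have h1 : IsGap u x (Finsupp.single m 1) :=
        ⟨Finsupp.single m 1, 0, 0, fun k => by simp [Finsupp.single_apply],
          by simpa [evalSum_single] using hpos m⟩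
      simpa using hsmul c hc h1.mem_gapCone
    · obtain ⟨K, hK⟩ := hu m
      refine ⟨(-c) * K, ?_⟩
      have h1 : IsGap u x (Finsupp.single u (K : ℝ) - Finsupp.single m 1) :=
        ⟨Finsupp.single u K, Finsupp.single m 1, 0, fun k => by
          simp only [Finsupp.sub_apply, Finsupp.single_apply]; push_cast; rfl,
          by simpa [evalSum_single] using hK⟩
      convert hsmul (-c) (by linarith) h1.mem_gapCone using 1
      simp [sub_eq_add_neg]

/-- Unless `(n + 1) • x ≤ n • u` for some `n`, there is a state normalized at the order unit `u`
whose value at `x` is at least `1`. This is a form of the Goodearl–Handelman extension theorem. -/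
theorem exists_state (hpos : ∀ a : M, 0 ≤ a) {u x : M}
    (hu : ∀ a : M, ∃ K : ℕ, a ≤ K • u) (hx : ∀ n : ℕ, ¬ (n + 1) • x ≤ n • u) :
    ∃ f : M →+ ℝ, Monotone f ∧ f u = 1 ∧ 1 ≤ f x := by
  classical
  have hne : ∀ c : ℝ, c • Finsupp.single u (1 : ℝ) = 0 → (RingHom.id ℝ) c • (1 : ℝ) = 0 := by
    intro c hc
    simpa using hc
  obtain ⟨g, hg, hgS⟩ := riesz_extension (gapCone u x)
    (LinearPMap.mkSpanSingleton' (Finsupp.single u (1 : ℝ)) (1 : ℝ) hne)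
    (by
      rintro ⟨y, hy⟩ hyS
      obtain ⟨c, rfl⟩ := Submodule.mem_span_singleton.1 hy
      rw [LinearPMap.mkSpanSingleton'_apply]
      simpa using nonneg_of_smul_single_mem_gapCone hpos hu hx hyS)
    (by
      intro y
      obtain ⟨d, hd⟩ := exists_smul_single_add_mem_gapCone (x := x) hpos hu y
      exact ⟨⟨d • Finsupp.single u 1, Submodule.smul_mem _ _ (Submodule.mem_span_singleton_self _)⟩,
        hd⟩)
  have hadd : ∀ a b : M, g (Finsupp.single (a + b) 1) =
      g (Finsupp.single a 1) + g (Finsupp.single b 1) := by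
    intro a b
    have h1 := hgS _ (IsGap.mem_gapCone (u := u) (x := x)
      (z := Finsupp.single (a + b) 1 - (Finsupp.single a 1 + Finsupp.single b 1))
      ⟨Finsupp.single (a + b) 1, Finsupp.single a 1 + Finsupp.single b 1, 0,
        fun m => by simp [Finsupp.single_apply], by simp [evalSum_single]⟩)
    have h2 := hgS _ (IsGap.mem_gapCone (u := u) (x := x)
      (z := (Finsupp.single a 1 + Finsupp.single b 1) - Finsupp.single (a + b) 1)
      ⟨Finsupp.single a 1 + Finsupp.single b 1, Finsupp.single (a + b) 1, 0,
        fun m => by simp [Finsupp.single_apply], by simp [evalSum_single]⟩)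
    simp only [map_sub, map_add] at h1 h2
    linarith
  have hgu : g (Finsupp.single u 1) = 1 :=
    (hg ⟨Finsupp.single u 1, Submodule.mem_span_singleton_self _⟩).trans
      (LinearPMap.mkSpanSingleton'_apply_self _ _ hne _)
  refine ⟨⟨⟨fun m => g (Finsupp.single m 1), ?_⟩, hadd⟩, ?_, hgu, ?_⟩
  · have := hadd 0 0
    rw [add_zero] at this
    linarith
  · intro a b hab
    have := hgS _ (isGap_single_sub_single (u := u) (x := x) hab).mem_gapCone
    rw [map_sub] at this
    exact sub_nonneg.1 this
  · have h1 : IsGap u x (Finsupp.single x 1 - Finsupp.single u 1) :=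
      ⟨Finsupp.single x 1, Finsupp.single u 1, 1, fun m => by simp [Finsupp.single_apply],
        by simp [evalSum_single, add_comm]⟩
    have h2 := hgS _ h1.mem_gapCone
    rw [map_sub, hgu] at h2
    exact sub_nonneg.1 h2

end State

/-! ### The preordered monoid of finite families of open sets -/

section OpenFamily

open TopologicalSpace

variable {X : Type*} [TopologicalSpace X]

variable {G : Type*} {ι κ : Type}

/-- Families with the same multiset of members differ by a bijection of their index types. -/
lemma exists_equiv_of_map_univ_eq {α : Type*} [Fintype ι] [Fintype κ] {A : ι → α} {B : κ → α}
    (h : Finset.univ.val.map A = Finset.univ.val.map B) : ∃ e : ι ≃ κ, ∀ i, B (e i) = A i := by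
  classical
  have hcard : ∀ c, Nonempty ({i // A i = c} ≃ {k // B k = c}) := by
    intro c
    have h1 := congrArg (Multiset.count c) h
    rw [Multiset.count_map, Multiset.count_map] at h1
    rw [← Fintype.card_eq, Fintype.card_subtype, Fintype.card_subtype]
    simpa [Finset.card, eq_comm] using h1
  exact ⟨Equiv.ofFiberEquiv fun c => (hcard c).some, fun i => Equiv.ofFiberEquiv_map _ i⟩

/-- The commutative monoid of finite families of open sets, a finite family being recorded as the
multiset of its members. The parameter `G` is kept since the preorder depends on the action. -/
def OpenFamily (_G X : Type*) [TopologicalSpace X] : Type _ := Multiset (Opens X)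

instance : AddCommMonoid (OpenFamily G X) := inferInstanceAs (AddCommMonoid (Multiset (Opens X)))

/-- The element of `OpenFamily G X` given by an indexed family. -/
def OpenFamily.mk (G : Type*) [Fintype ι] (A : ι → Opens X) : OpenFamily G X :=
  (Finset.univ.val.map A : Multiset (Opens X))

lemma OpenFamily.exists_mk (a : OpenFamily G X) :
    ∃ (n : ℕ) (A : Fin n → Opens X), OpenFamily.mk G A = a := by
  obtain ⟨l, hl⟩ := Quot.exists_rep a
  refine ⟨l.length, l.get, ?_⟩
  rw [← hl]
  change (Finset.univ.val.map l.get : Multiset (Opens X)) = l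
  rw [Fin.univ_val_map, List.ofFn_get]

lemma OpenFamily.mk_sumElim [Fintype ι] [Fintype κ] (A : ι → Opens X) (B : κ → Opens X) :
    OpenFamily.mk G (Sum.elim A B) = OpenFamily.mk G A + OpenFamily.mk G B := by
  change Multiset.map _ (Multiset.disjSum _ _) = (Multiset.map A _ + Multiset.map B _)
  simp [Multiset.disjSum, Multiset.map_map]

lemma OpenFamily.mk_cond (V W : Opens X) :
    OpenFamily.mk G (fun b : Bool => cond b V W) =
      OpenFamily.mk G (fun _ : Unit => V) + OpenFamily.mk G (fun _ : Unit => W) := rfl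

lemma OpenFamily.mk_const (n : ℕ) (V : Opens X) :
    OpenFamily.mk G (fun _ : Fin n => V) = n • OpenFamily.mk G (fun _ : Unit => V) := by
  change Multiset.map _ _ = (n • ({V} : Multiset (Opens X)))
  simp [Multiset.nsmul_singleton]

/-- A strengthening of the relation `SeqSubequiv` that does not refer to closed sets. The open set
`U i g k` is the part of `A i` that `g` moves into the level `k`; the parts cover `A i`, and the
moved parts in each level are pairwise disjoint. Infinitely many parts are allowed, since compactness
leaves finitely many of them over each closed subset of `A i`. -/
def FamilySubequiv (G : Type*) [Group G] [MulAction G X] {ι κ : Type}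
    (A : ι → Opens X) (B : κ → Opens X) : Prop :=
  ∃ U : ι → G → κ → Set X,
    (∀ i g k, IsOpen (U i g k)) ∧
    (∀ i, ∀ x ∈ A i, ∃ g k, x ∈ U i g k) ∧
    (∀ i g k, ∀ x ∈ U i g k, g • x ∈ B k) ∧
    (∀ i i' g g' k x x', x ∈ U i g k → x' ∈ U i' g' k → g • x = g' • x' → i = i' ∧ g = g')

variable [Group G] [MulAction G X]

lemma FamilySubequiv.of_injective {A : ι → Opens X} {B : κ → Opens X} (e : ι → κ)
    (he : Function.Injective e) (h : ∀ i, A i ≤ B (e i)) : FamilySubequiv G A B := by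
  refine ⟨fun i g k => {x | x ∈ A i ∧ g = 1 ∧ k = e i}, fun i g k => ?_, fun i x hx => ?_, ?_, ?_⟩
  · exact (A i).2.and isOpen_const
  · exact ⟨1, e i, hx, rfl, rfl⟩
  · rintro i g k x ⟨hx, rfl, rfl⟩
    rw [one_smul]
    exact h i hx
  · rintro i i' g g' k x x' ⟨hx, rfl, rfl⟩ ⟨hx', rfl, hk⟩ -
    exact ⟨he hk, rfl⟩

lemma FamilySubequiv.trans [ContinuousConstSMul G X] {ν : Type} {A : ι → Opens X}
    {B : κ → Opens X} {C : ν → Opens X} (h₁ : FamilySubequiv G A B) (h₂ : FamilySubequiv G B C) :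
    FamilySubequiv G A C := by
  obtain ⟨U, hUo, hUc, hUB, hUd⟩ := h₁
  obtain ⟨W, hWo, hWc, hWC, hWd⟩ := h₂
  refine ⟨fun i c l => ⋃ (g : G) (k : κ), U i g k ∩ (fun x => g • x) ⁻¹' W k (c * g⁻¹) l,
    fun i c l => ?_, fun i x hx => ?_, ?_, ?_⟩
  · exact isOpen_iUnion fun g => isOpen_iUnion fun k =>
      (hUo i g k).inter ((hWo k _ l).preimage (continuous_const_smul g))
  · obtain ⟨g, k, hgk⟩ := hUc i x hx
    obtain ⟨h, l, hhl⟩ := hWc k _ (hUB i g k x hgk)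
    refine ⟨h * g, l, ?_⟩
    simp only [Set.mem_iUnion]
    exact ⟨g, k, hgk, by simpa using hhl⟩
  · intro i c l x hx
    simp only [Set.mem_iUnion] at hx
    obtain ⟨g, k, hgk, hx⟩ := hx
    simpa [smul_smul] using hWC k _ l _ hx
  · intro i i' c c' l x x' hx hx' heq
    simp only [Set.mem_iUnion] at hx hx'
    obtain ⟨g, k, hgk, hx⟩ := hx
    obtain ⟨g', k', hgk', hx'⟩ := hx'
    obtain ⟨rfl, hcc⟩ := hWd k k' _ _ l _ _ hx hx' (by simpa [smul_smul] using heq)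
    have hgx : g • x = g' • x' := by
      have h1 : (c * g⁻¹) • g • x = (c' * g'⁻¹) • g' • x' := by simpa [smul_smul] using heq
      rw [hcc] at h1
      exact smul_left_cancel _ h1
    obtain ⟨rfl, rfl⟩ := hUd i i' g g' k x x' hgk hgk' hgx
    exact ⟨rfl, mul_right_cancel hcc⟩

lemma FamilySubequiv.sumElim {ν : Type} {A : ι → Opens X} {B : κ → Opens X}
    (h : FamilySubequiv G A B) (C : ν → Opens X) :
    FamilySubequiv G (Sum.elim A C) (Sum.elim B C) := by
  obtain ⟨U, hUo, hUc, hUB, hUd⟩ := h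
  refine ⟨fun i g k => {x | (∃ i₀ k₀, i = .inl i₀ ∧ k = .inl k₀ ∧ x ∈ U i₀ g k₀) ∨
    ∃ j, i = .inr j ∧ k = .inr j ∧ g = 1 ∧ x ∈ C j}, ?_, ?_, ?_, ?_⟩
  · rintro (i | i) g (k | k) <;> simp [hUo]
    by_cases hik : k = i
    · subst hik
      by_cases hg : g = 1
      · simpa [hg] using (C k).2
      · simp [hg]
    · simp [hik]
  · rintro (i | i) x hx
    · obtain ⟨g, k, hgk⟩ := hUc i x hx
      exact ⟨g, .inl k, .inl ⟨i, k, rfl, rfl, hgk⟩⟩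
    · exact ⟨1, .inr i, .inr ⟨i, rfl, rfl, rfl, hx⟩⟩
  · rintro i g k x (⟨i, k, rfl, rfl, hx⟩ | ⟨j, rfl, rfl, rfl, hx⟩)
    · exact hUB i g k x hx
    · simpa using hx
  · rintro i i' g g' k x x' (⟨i, k, rfl, rfl, hx⟩ | ⟨j, rfl, rfl, rfl, hx⟩)
      (⟨i', k', rfl, hk, hx'⟩ | ⟨j', rfl, hk, rfl, hx'⟩) heq
    · obtain rfl := Sum.inl_injective hk
      obtain ⟨rfl, rfl⟩ := hUd i i' g g' k x x' hx hx' heq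
      exact ⟨rfl, rfl⟩
    · cases hk
    · cases hk
    · obtain rfl := Sum.inr_injective hk
      exact ⟨rfl, rfl⟩

lemma FamilySubequiv.singleton_sup (V W : Opens X) :
    FamilySubequiv G (fun _ : Unit => V ⊔ W) (fun b : Bool => cond b V W) := by
  refine ⟨fun _ g b => {x | x ∈ cond b V W ∧ g = 1}, ?_, ?_, ?_, ?_⟩
  · exact fun _ g b => (cond b V W).2.and isOpen_const
  · rintro - x (hx | hx)
    · exact ⟨1, true, hx, rfl⟩
    · exact ⟨1, false, hx, rfl⟩
  · rintro - g b x ⟨hx, rfl⟩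
    simpa using hx
  · rintro ⟨⟩ ⟨⟩ g g' b x x' ⟨-, rfl⟩ ⟨-, rfl⟩ -
    exact ⟨rfl, rfl⟩

lemma FamilySubequiv.pair_of_disjoint {V W : Opens X} (h : Disjoint (V : Set X) W) :
    FamilySubequiv G (fun b : Bool => cond b V W) (fun _ : Unit => V ⊔ W) := by
  refine ⟨fun b g _ => {x | x ∈ cond b V W ∧ g = 1}, ?_, ?_, ?_, ?_⟩
  · exact fun b g _ => (cond b V W).2.and isOpen_const
  · exact fun b x hx => ⟨1, (), hx, rfl⟩
  · rintro b g - x ⟨hx, rfl⟩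
    rw [one_smul]
    cases b
    · exact .inr hx
    · exact .inl hx
  · rintro b b' g g' - x x' ⟨hx, rfl⟩ ⟨hx', rfl⟩ heq
    rw [one_smul, one_smul] at heq
    subst heq
    refine ⟨?_, rfl⟩
    cases b <;> cases b'
    · rfl
    · exact (Set.disjoint_left.1 h hx' hx).elim
    · exact (Set.disjoint_left.1 h hx hx').elim
    · rfl

lemma FamilySubequiv.of_smul {V W : Opens X} (g : G) (h : ∀ x ∈ V, g • x ∈ W) :
    FamilySubequiv G (fun _ : Unit => V) (fun _ : Unit => W) := by
  refine ⟨fun _ g' _ => {x | x ∈ V ∧ g' = g}, ?_, ?_, ?_, ?_⟩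
  · exact fun _ g _ => V.2.and isOpen_const
  · exact fun _ x hx => ⟨g, (), hx, rfl⟩
  · rintro - g' - x ⟨hx, rfl⟩
    exact h x hx
  · rintro ⟨⟩ ⟨⟩ g' g'' - x x' ⟨-, rfl⟩ ⟨-, rfl⟩ -
    exact ⟨rfl, rfl⟩

/-- Each open set embeds into finitely many copies of an open set that meets every orbit. -/
lemma FamilySubequiv.exists_copies [ContinuousConstSMul G X] [CompactSpace X] {O : Opens X}
    (hO : ∀ x : X, ∃ g : G, g • x ∈ O) (V : Opens X) :
    ∃ K : ℕ, FamilySubequiv G (fun _ : Unit => V) (fun _ : Fin K => O) := by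
  have hopen : ∀ g : G, IsOpen ((fun x : X => g • x) ⁻¹' (O : Set X)) :=
    fun g => O.2.preimage (continuous_const_smul g)
  obtain ⟨t, ht⟩ := isCompact_univ.elim_finite_subcover _ hopen
    (fun x _ => Set.mem_iUnion.2 (hO x))
  refine ⟨t.card, fun _ g k => {x | (x ∈ V ∧ g • x ∈ O) ∧ g = t.equivFin.symm k}, ?_, ?_, ?_, ?_⟩
  · exact fun _ g k => (V.2.inter (hopen g)).and isOpen_const
  · intro _ x hx
    have hxt := ht (Set.mem_univ x)
    simp only [Set.mem_iUnion] at hxt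
    obtain ⟨g, hg, hgx⟩ := hxt
    exact ⟨g, t.equivFin ⟨g, hg⟩, ⟨hx, hgx⟩, by simp⟩
  · exact fun _ g k x hx => hx.1.2
  · rintro ⟨⟩ ⟨⟩ g g' k x x' ⟨-, hg⟩ ⟨-, hg'⟩ -
    exact ⟨rfl, hg.trans hg'.symm⟩

/-- By compactness the relation `FamilySubequiv` implies `SeqSubequiv`. -/
lemma FamilySubequiv.seqSubequiv [CompactSpace X] {n m : ℕ} {A : Fin n → Opens X}
    {B : Fin m → Opens X} (h : FamilySubequiv G A B) :
    SeqSubequiv G (fun i => (A i : Set X)) (fun k => (B k : Set X)) := by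
  obtain ⟨U, hUo, hUc, hUB, hUd⟩ := h
  intro F hF hFA
  have hfin : ∀ i, ∃ t : Finset (G × Fin m), F i ⊆ ⋃ p ∈ t, U i p.1 p.2 := fun i =>
    (hF i).isCompact.elim_finite_subcover (fun p : G × Fin m => U i p.1 p.2)
      (fun p => hUo i p.1 p.2) (fun x hx => by
        obtain ⟨g, k, hgk⟩ := hUc i x (hFA i hx)
        exact Set.mem_iUnion.2 ⟨(g, k), hgk⟩)
  choose t ht using hfin
  let φ : (Σ i, Fin (t i).card) → G × Fin m := fun p => ((t p.1).equivFin.symm p.2 : G × Fin m)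
  refine ⟨fun i => (t i).card, fun p => U p.1 (φ p).1 (φ p).2, fun p => (φ p).1,
    fun p => (φ p).2, fun p => hUo _ _ _, fun i x hx => ?_, ?_, ?_⟩
  · have := ht i hx
    simp only [Set.mem_iUnion] at this
    obtain ⟨p, hp, hxp⟩ := this
    refine Set.mem_iUnion.2 ⟨(t i).equivFin ⟨p, hp⟩, ?_⟩
    simpa [φ] using hxp
  · intro p q hpq
    rw [Set.disjoint_left]
    rintro ⟨y, k⟩ ⟨⟨x, hx, hxy⟩, hk⟩ ⟨⟨x', hx', hxy'⟩, hk'⟩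
    have hk1 : k = (φ p).2 := hk
    have hk2 : k = (φ q).2 := hk'
    dsimp only at hx hx' hxy hxy'
    rw [← hk1] at hx
    rw [← hk2] at hx'
    obtain ⟨h1, h2⟩ := hUd p.1 q.1 _ _ k x x' hx hx' (hxy.trans hxy'.symm)
    apply hpq
    have hφ : φ p = φ q := Prod.ext h2 (hk1.symm.trans hk2)
    obtain ⟨i, j⟩ := p
    obtain ⟨i', j'⟩ := q
    dsimp only at h1
    subst h1
    have : j = j' := (t i).equivFin.symm.injective (Subtype.ext hφ)
    rw [this]
  · rintro ⟨y, k⟩ hy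
    obtain ⟨p, ⟨x, hx, rfl⟩, hk⟩ := Set.mem_iUnion.1 hy
    have hk1 : k = (φ p).2 := hk
    refine Set.mem_iUnion.2 ⟨k, ?_, rfl⟩
    rw [hk1]
    exact hUB _ _ _ _ hx

variable [ContinuousConstSMul G X]

instance : Preorder (OpenFamily G X) where
  le a b := ∃ (n m : ℕ) (A : Fin n → Opens X) (B : Fin m → Opens X),
    OpenFamily.mk G A = a ∧ OpenFamily.mk G B = b ∧ FamilySubequiv G A B
  le_refl a := by
    obtain ⟨n, A, rfl⟩ := a.exists_mk
    exact ⟨n, n, A, A, rfl, rfl, .of_injective id Function.injective_id fun _ => le_rfl⟩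
  le_trans := by
    rintro _ _ _ ⟨n, m, A, B, rfl, rfl, h⟩ ⟨m', l, B', C, hB, rfl, h'⟩
    obtain ⟨e, he⟩ := exists_equiv_of_map_univ_eq hB
    have hBB' : FamilySubequiv G B B' :=
      .of_injective e.symm e.symm.injective fun i => by rw [← he, e.apply_symm_apply]
    exact ⟨n, l, A, C, rfl, rfl, h.trans (hBB'.trans h')⟩

lemma OpenFamily.mk_le_mk [Fintype ι] [Fintype κ] {A : ι → Opens X} {B : κ → Opens X} :
    OpenFamily.mk G A ≤ OpenFamily.mk G B ↔ FamilySubequiv G A B := by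
  constructor
  · rintro ⟨n, m, A', B', hA, hB, h⟩
    obtain ⟨e, he⟩ := exists_equiv_of_map_univ_eq hA
    obtain ⟨e', he'⟩ := exists_equiv_of_map_univ_eq hB
    have h1 : FamilySubequiv G A A' :=
      .of_injective e.symm e.symm.injective fun i => by rw [← he, e.apply_symm_apply]
    have h2 : FamilySubequiv G B' B := .of_injective e' e'.injective fun i => by rw [he']
    exact h1.trans (h.trans h2)
  · intro h
    let eι := Fintype.equivFin ι
    let eκ := Fintype.equivFin κ
    have key : ∀ {ν : Type} [Fintype ν] (C : ν → Opens X),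
        OpenFamily.mk G (C ∘ (Fintype.equivFin ν).symm) = OpenFamily.mk G C := by
      intro ν _ C
      change Multiset.map _ _ = Multiset.map _ _
      rw [← Multiset.map_map]
      congr 1
      exact congrArg Finset.val (Finset.map_univ_equiv (Fintype.equivFin ν).symm)
    refine ⟨_, _, A ∘ eι.symm, B ∘ eκ.symm, key A, key B, ?_⟩
    have h1 : FamilySubequiv G (A ∘ eι.symm) A :=
      .of_injective eι.symm eι.symm.injective fun i => le_rfl
    have h2 : FamilySubequiv G B (B ∘ eκ.symm) :=
      .of_injective eκ eκ.injective fun i => by simp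
    exact h1.trans (h.trans h2)

instance : IsOrderedAddMonoid (OpenFamily G X) where
  add_le_add_left := by
    rintro _ _ ⟨n, m, A, B, rfl, rfl, h⟩ c
    obtain ⟨l, C, rfl⟩ := c.exists_mk
    rw [← OpenFamily.mk_sumElim, ← OpenFamily.mk_sumElim, OpenFamily.mk_le_mk]
    exact h.sumElim C

lemma OpenFamily.zero_le (a : OpenFamily G X) : 0 ≤ a := by
  obtain ⟨n, A, rfl⟩ := a.exists_mk
  exact ⟨0, n, Fin.elim0, A, rfl, rfl, .of_injective Fin.elim0 (fun i => i.elim0) fun i => i.elim0⟩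

lemma OpenFamily.exists_le_nsmul [CompactSpace X] {O : Opens X}
    (hO : ∀ x : X, ∃ g : G, g • x ∈ O) (a : OpenFamily G X) :
    ∃ K : ℕ, a ≤ K • OpenFamily.mk G (fun _ : Unit => O) := by
  induction a using Multiset.induction_on with
  | empty => exact ⟨0, OpenFamily.zero_le _⟩
  | cons V a ih =>
    obtain ⟨K, hK⟩ := ih
    obtain ⟨K', hK'⟩ := FamilySubequiv.exists_copies hO V
    refine ⟨K' + K, ?_⟩
    rw [← OpenFamily.mk_le_mk, OpenFamily.mk_const] at hK'
    rw [add_nsmul]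
    exact add_le_add hK' hK

end OpenFamily

/-! ### Invariant measures from invariant contents on open sets -/

section OpenContent

open TopologicalSpace
open scoped NNReal ENNReal

/-- A finitely subadditive function on open sets that is superadditive on disjoint pairs and
monotone up to translation by elements of `G`. -/
structure OpenContent (G X : Type*) [Group G] [MulAction G X] [TopologicalSpace X] where
  /-- The value on an open set. -/
  toFun : Opens X → ℝ≥0
  le_of_smul : ∀ (g : G) (V W : Opens X), (∀ x ∈ V, g • x ∈ W) → toFun V ≤ toFun W
  map_sup_le : ∀ V W : Opens X, toFun (V ⊔ W) ≤ toFun V + toFun W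
  add_le_map_sup : ∀ V W : Opens X, Disjoint (V : Set X) W → toFun V + toFun W ≤ toFun (V ⊔ W)

namespace OpenContent

variable {G X : Type*} [Group G] [MulAction G X] [TopologicalSpace X] (D : OpenContent G X)

/-- The content given by a nonnegative real-valued function on open sets. -/
noncomputable def ofReal (r : Opens X → ℝ) (hr : ∀ V, 0 ≤ r V)
    (hsmul : ∀ (g : G) (V W : Opens X), (∀ x ∈ V, g • x ∈ W) → r V ≤ r W)
    (hsup : ∀ V W : Opens X, r (V ⊔ W) ≤ r V + r W)
    (hadd : ∀ V W : Opens X, Disjoint (V : Set X) W → r V + r W ≤ r (V ⊔ W)) :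
    OpenContent G X where
  toFun V := (r V).toNNReal
  le_of_smul g V W h := Real.toNNReal_le_toNNReal (hsmul g V W h)
  map_sup_le V W := by
    rw [← Real.toNNReal_add (hr V) (hr W)]
    exact Real.toNNReal_le_toNNReal (hsup V W)
  add_le_map_sup V W h := by
    rw [← Real.toNNReal_add (hr V) (hr W)]
    exact Real.toNNReal_le_toNNReal (hadd V W h)

lemma mono {V W : Opens X} (h : V ≤ W) : D.toFun V ≤ D.toFun W :=
  D.le_of_smul 1 V W fun x hx => by rw [one_smul]; exact h hx

/-- The infimum of the values on the open neighbourhoods of a compact set. -/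
noncomputable def outer (K : Compacts X) : ℝ≥0 := ⨅ V : {V : Opens X // (K : Set X) ⊆ V}, D.toFun V

instance (K : Compacts X) : Nonempty {V : Opens X // (K : Set X) ⊆ V} := ⟨⟨⊤, Set.subset_univ _⟩⟩

lemma outer_le {K : Compacts X} {V : Opens X} (h : (K : Set X) ⊆ V) : D.outer K ≤ D.toFun V :=
  ciInf_le (OrderBot.bddBelow _) (⟨V, h⟩ : {V : Opens X // (K : Set X) ⊆ V})

lemma le_outer {K : Compacts X} {r : ℝ≥0} (h : ∀ V : Opens X, (K : Set X) ⊆ V → r ≤ D.toFun V) :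
    r ≤ D.outer K :=
  le_ciInf fun V => h V V.2

lemma outer_sup_le (K₁ K₂ : Compacts X) : D.outer (K₁ ⊔ K₂) ≤ D.outer K₁ + D.outer K₂ := by
  refine NNReal.le_iInf_add_iInf fun V W => ?_
  refine (D.outer_le (V := V.1 ⊔ W.1) ?_).trans (D.map_sup_le _ _)
  exact Set.union_subset_union V.2 W.2

/-- The content in the sense of Mathlib defined by `OpenContent.outer`. -/
noncomputable def content [T2Space X] : Content X where
  toFun := D.outer
  mono' K₁ K₂ h := D.le_outer fun V hV => D.outer_le (h.trans hV)
  sup_le' := D.outer_sup_le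
  sup_disjoint' K₁ K₂ h _ _ := by
    apply le_antisymm
    · exact D.outer_sup_le K₁ K₂
    · refine D.le_outer fun U hU => ?_
      obtain ⟨V, W, hV, hW, hKV, hKW, hVW⟩ := SeparatedNhds.of_isCompact_isCompact
        K₁.isCompact K₂.isCompact h
      have hU' : (K₁ : Set X) ∪ K₂ ⊆ U := hU
      have h1 : D.outer K₁ ≤ D.toFun (U ⊓ ⟨V, hV⟩) :=
        D.outer_le (Set.subset_inter (Set.subset_union_left.trans hU') hKV)
      have h2 : D.outer K₂ ≤ D.toFun (U ⊓ ⟨W, hW⟩) :=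
        D.outer_le (Set.subset_inter (Set.subset_union_right.trans hU') hKW)
      refine (add_le_add h1 h2).trans ((D.add_le_map_sup _ _ ?_).trans (D.mono ?_))
      · exact hVW.mono Set.inter_subset_right Set.inter_subset_right
      · exact sup_le inf_le_left inf_le_left

lemma content_apply [T2Space X] (K : Compacts X) : D.content K = (D.outer K : ℝ≥0∞) := rfl

lemma outer_map_smul [ContinuousConstSMul G X] (g : G) (K : Compacts X) :
    D.outer (K.map (Homeomorph.smul g) (Homeomorph.smul g).continuous) = D.outer K := by
  have key : ∀ (g : G) (K L : Compacts X), (∀ x ∈ L, g • x ∈ K) → D.outer L ≤ D.outer K := by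
    intro g K L h
    refine D.le_outer fun V hV => ?_
    let W : Opens X := ⟨(fun x => g • x) ⁻¹' V, V.2.preimage (continuous_const_smul g)⟩
    have h1 : (L : Set X) ⊆ W := fun x hx => hV (h x hx)
    exact (D.outer_le h1).trans (D.le_of_smul g W V fun x hx => hx)
  apply le_antisymm
  · refine key g⁻¹ _ _ ?_
    rintro _ ⟨x, hx, rfl⟩
    simpa using hx
  · exact key g _ _ fun x hx => ⟨x, hx, rfl⟩

/-- The values of the measure interpolate between those of the content: a compactly contained open
set bounds the measure from below, and the open set itself bounds it from above. -/
lemma exists_invariantMeasure [ContinuousConstSMul G X] [CompactSpace X] [T2Space X]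
    [MeasurableSpace X] [BorelSpace X] (hD : D.toFun ⊤ ≠ 0) :
    ∃ μ ∈ invariantMeasures G X,
      (∀ V : Opens X, (D.toFun ⊤ : ℝ≥0∞) * μ V ≤ D.toFun V) ∧
      (∀ V W : Opens X, closure (W : Set X) ⊆ V → (D.toFun W : ℝ≥0∞) ≤ D.toFun ⊤ * μ V) := by
  set ν := D.content.measure with hν
  have hopen : ∀ V : Opens X, ν V = D.content.innerContent V := fun V => by
    rw [hν, Content.measure_apply _ V.isOpen.measurableSet, Content.outerMeasure_opens]
  have hle : ∀ V : Opens X, ν V ≤ D.toFun V := fun V => by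
    rw [hopen]
    exact iSup₂_le fun K hK => ENNReal.coe_le_coe.2 (D.outer_le hK)
  have hge : ∀ V W : Opens X, closure (W : Set X) ⊆ V → (D.toFun W : ℝ≥0∞) ≤ ν V := by
    intro V W h
    rw [hopen]
    refine le_trans ?_ (D.content.le_innerContent ⟨closure W, isClosed_closure.isCompact⟩ V h)
    rw [content_apply, ENNReal.coe_le_coe]
    exact D.le_outer fun U hU => D.mono (subset_closure.trans hU)
  have huniv : ν Set.univ = D.toFun ⊤ :=
    le_antisymm (hle ⊤) (hge ⊤ ⊤ (Set.subset_univ _))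
  have hinv : SMulInvariantMeasure G X ν := by
    refine ⟨fun g s hs => ?_⟩
    rw [hν, Content.measure_apply _ hs,
      Content.measure_apply _ (hs.preimage (continuous_const_smul g).measurable)]
    exact D.content.outerMeasure_preimage (Homeomorph.smul g)
      (fun K => by rw [content_apply, content_apply, outer_map_smul]) s
  have h0 : (D.toFun ⊤ : ℝ≥0∞) ≠ 0 := by simpa using hD
  have hcancel : ∀ s : Set X, (D.toFun ⊤ : ℝ≥0∞) * (((D.toFun ⊤)⁻¹ : ℝ≥0) • ν) s = ν s := by
    intro s
    rw [Measure.smul_apply, ENNReal.smul_def, smul_eq_mul, ← mul_assoc, ENNReal.coe_inv hD,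
      ENNReal.mul_inv_cancel h0 ENNReal.coe_ne_top, one_mul]
  refine ⟨((D.toFun ⊤)⁻¹ : ℝ≥0) • ν, ⟨⟨?_⟩, ?_, ?_⟩, fun V => ?_, fun V W h => ?_⟩
  · have := hcancel Set.univ
    rw [huniv] at this
    exact (ENNReal.mul_eq_left h0 ENNReal.coe_ne_top).1 this
  · infer_instance
  · infer_instance
  · rw [hcancel]; exact hle V
  · rw [hcancel]; exact hge V W h

end OpenContent

end OpenContent

/-! ### Amenability and recurrence to sets of positive measure -/

section Amenable

open TopologicalSpace

variable {G X : Type*} [Group G] [MulAction G X]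

/-- The indicator function on `G` of the times at which the orbit of `y` visits `V`. -/
noncomputable def visitIndicator (G : Type*) {X : Type*} [Group G] [MulAction G X] (y : X)
    (V : Set X) : boundedFunctions G :=
  ⟨fun h => V.indicator 1 (h • y), 1, fun h => by
    by_cases hy : h • y ∈ V <;> simp [hy]⟩

lemma visitIndicator_apply (y : X) (V : Set X) (h : G) :
    (visitIndicator G y V : G → ℝ) h = V.indicator 1 (h • y) := rfl

lemma visitIndicator_nonneg (y : X) (V : Set X) (h : G) :
    0 ≤ (visitIndicator G y V : G → ℝ) h :=
  Set.indicator_nonneg (fun _ _ => zero_le_one) _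

/-- The mean time that the orbit of `y` spends in an open set is an invariant content. The measure
it defines gives mass zero to an open set that the orbit avoids. -/
lemma exists_smul_mem_of_isAmenable [TopologicalSpace X] [ContinuousConstSMul G X]
    [CompactSpace X] [T2Space X] [MeasurableSpace X] [BorelSpace X] (hG : IsAmenable G)
    (O : Opens X) (hO : ∀ μ ∈ invariantMeasures G X, 0 < μ O) (y : X) : ∃ g : G, g • y ∈ O := by
  by_contra! hy
  obtain ⟨m, hpos, hone, hinv⟩ := hG
  have hmono : ∀ f f' : boundedFunctions G, (∀ h, (f : G → ℝ) h ≤ (f' : G → ℝ) h) → m f ≤ m f' := by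
    intro f f' h
    have h1 := hpos (f' - f) fun g => sub_nonneg.2 (h g)
    rw [map_sub] at h1
    exact sub_nonneg.1 h1
  let D : OpenContent G X :=
    .ofReal (fun V => m (visitIndicator G y V)) (fun V => hpos _ (visitIndicator_nonneg y V))
      (by
        intro g V W h
        refine (hmono _ (leftTranslate g⁻¹ (visitIndicator G y W)) fun k => ?_).trans_eq (hinv _ _)
        change (V : Set X).indicator (1 : X → ℝ) (k • y) ≤
          (W : Set X).indicator (1 : X → ℝ) ((g⁻¹⁻¹ * k) • y)
        rw [inv_inv, mul_smul]
        by_cases hk : k • y ∈ (V : Set X)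
        · have hk' : g • k • y ∈ (W : Set X) := h _ hk
          simp [hk, hk']
        · rw [Set.indicator_of_notMem hk]
          exact Set.indicator_nonneg (fun _ _ => zero_le_one) _)
      (by
        intro V W
        refine (hmono _ (visitIndicator G y V + visitIndicator G y W) fun k => ?_).trans_eq
          (map_add _ _ _)
        change ((V : Set X) ∪ W).indicator (1 : X → ℝ) (k • y) ≤
          (V : Set X).indicator 1 (k • y) + (W : Set X).indicator 1 (k • y)
        by_cases hV : k • y ∈ (V : Set X) <;> by_cases hW : k • y ∈ (W : Set X) <;> simp [hV, hW])
      (by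
        intro V W hVW
        refine (map_add m _ _).symm.trans_le (hmono _ _ fun k => ?_)
        change (V : Set X).indicator 1 (k • y) + (W : Set X).indicator 1 (k • y) ≤
          ((V : Set X) ∪ W).indicator (1 : X → ℝ) (k • y)
        by_cases hV : k • y ∈ (V : Set X)
        · have hW : k • y ∉ (W : Set X) := Set.disjoint_left.1 hVW hV
          simp [hV, hW]
        · by_cases hW : k • y ∈ (W : Set X) <;> simp [hV, hW])
  have htop : D.toFun ⊤ = 1 := by
    refine (congrArg Real.toNNReal (hone _ fun h => ?_)).trans Real.toNNReal_one
    rw [visitIndicator_apply]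
    simp
  have hzero : D.toFun O = 0 := by
    have h1 : visitIndicator G y (O : Set X) = 0 :=
      Subtype.ext (funext fun h => Set.indicator_of_notMem (hy h) _)
    change (m (visitIndicator G y O)).toNNReal = 0
    rw [h1, map_zero, Real.toNNReal_zero]
  obtain ⟨μ, hμ, hle, -⟩ := D.exists_invariantMeasure (by simp [htop])
  have h1 := hle O
  rw [htop, hzero] at h1
  have h2 := hO μ hμ
  simp at h1
  exact h2.ne' h1

end Amenable

/-! ### Comparison by measures against comparison of multiples -/

section Comparison

open TopologicalSpace

variable {G X : Type*} [Group G] [MulAction G X] [TopologicalSpace X] [ContinuousConstSMul G X]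

/-- Invariant measures are monotone with respect to the comparison of multiples. -/
lemma nsmul_measure_le_of_mulSubequiv [T2Space X] [MeasurableSpace X] [BorelSpace X]
    {μ : Measure X} (hμ : μ ∈ invariantMeasures G X) {n m : ℕ} {A B : Set X} (hA : IsOpen A)
    (h : MulSubequiv G n A m B) : n * μ A ≤ m * μ B := by
  classical
  obtain ⟨-, hreg, hinv⟩ := hμ
  rw [hA.measure_eq_iSup_isCompact, ENNReal.mul_iSup]
  refine iSup_le fun K => ?_
  rw [ENNReal.mul_iSup]
  refine iSup_le fun hKA => ?_
  rw [ENNReal.mul_iSup]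
  refine iSup_le fun hK => ?_
  obtain ⟨J, U, s, k, hUo, hcov, hdisj, hsub⟩ := h (fun _ => K) (fun _ => hK.isClosed) fun _ => hKA
  have hsubB : ∀ p, s p • U p ⊆ B := by
    intro p y hy
    have h1 := hsub (Set.mem_iUnion.2 ⟨p, (⟨hy, rfl⟩ : (y, k p) ∈ (s p • U p) ×ˢ {k p})⟩)
    obtain ⟨l, hl⟩ := Set.mem_iUnion.1 h1
    exact hl.1
  calc (n : ENNReal) * μ K = ∑ _i : Fin n, μ K := by simp
    _ ≤ ∑ i : Fin n, ∑ j : Fin (J i), μ (U ⟨i, j⟩) := by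
      gcongr with i
      exact (measure_mono (hcov i)).trans (measure_iUnion_fintype_le _ _)
    _ = ∑ p, μ (U p) := (Fintype.sum_sigma fun p => μ (U p)).symm
    _ = ∑ p, μ (s p • U p) := by simp_rw [measure_smul]
    _ = ∑ l : Fin m, ∑ p with k p = l, μ (s p • U p) := (Finset.sum_fiberwise _ _ _).symm
    _ ≤ ∑ _l : Fin m, μ B := by
      gcongr with l
      rw [← measure_biUnion_finset]
      · exact measure_mono (Set.iUnion₂_subset fun p _ => hsubB p)
      · intro p hp q hq hpq
        have hkp : k p = l := by simpa using hp
        have hkq : k q = l := by simpa using hq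
        have h1 := hdisj hpq
        simp only [hkp, hkq, Set.disjoint_prod] at h1
        simpa using h1
      · exact fun p _ => ((hUo p).smul (s p)).measurableSet
    _ = m * μ B := by simp

lemma openSubequiv_of_hasDynamicalComparison [T2Space X] [MeasurableSpace X] [BorelSpace X]
    (hcomp : HasDynamicalComparison G X) {A B : Set X} (hA : IsOpen A) (hB : IsOpen B)
    (hpos : ∀ μ ∈ invariantMeasures G X, 0 < μ B) {n : ℕ} (h : MulSubequiv G (n + 1) A n B) :
    OpenSubequiv G A B := by
  rcases B.eq_empty_or_nonempty with rfl | hne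
  · -- There may be no invariant measure here; but nothing nonempty fits into copies of `∅`.
    have hA0 : A = ∅ := by
      refine Set.eq_empty_of_forall_notMem fun x hx => ?_
      obtain ⟨J, U, s, k, -, hcov, -, hsub⟩ := h (fun _ => {x}) (fun _ => isClosed_singleton)
        fun _ => Set.singleton_subset_iff.2 hx
      obtain ⟨j, hj⟩ := Set.mem_iUnion.1 (hcov 0 rfl)
      have h1 := hsub (Set.mem_iUnion.2 ⟨⟨0, j⟩, (⟨Set.smul_mem_smul_set hj, rfl⟩ :
        (s ⟨0, j⟩ • x, k ⟨0, j⟩) ∈ (s ⟨0, j⟩ • U ⟨0, j⟩) ×ˢ {k ⟨0, j⟩})⟩)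
      obtain ⟨l, hl⟩ := Set.mem_iUnion.1 h1
      exact hl.1
    intro F _ hFA
    rw [hA0] at hFA
    exact ⟨0, Fin.elim0, Fin.elim0, fun j => j.elim0, hFA.trans (Set.empty_subset _),
      fun j => j.elim0, fun j => j.elim0⟩
  · refine hcomp A B hA hB hne fun μ hμ => ?_
    have hprob : IsProbabilityMeasure μ := hμ.1
    have h1 := nsmul_measure_le_of_mulSubequiv hμ hA h
    by_contra! hle
    have h2 : ((n + 1 : ℕ) : ENNReal) * μ B ≤ n * μ B := le_trans (by gcongr) h1
    have hfin : (n : ENNReal) * μ B ≠ ⊤ := by finiteness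
    rw [Nat.cast_add, Nat.cast_one, add_mul, one_mul] at h2
    exact (ENNReal.lt_add_right hfin (hpos μ hμ).ne').not_ge h2

/-- A state on families of open sets restricts to an invariant content on open sets. -/
noncomputable def OpenContent.ofState (f : OpenFamily G X →+ ℝ) (hf : Monotone f) :
    OpenContent G X :=
  .ofReal (fun V => f (OpenFamily.mk G fun _ : Unit => V))
    (fun V => by simpa using hf (OpenFamily.zero_le (OpenFamily.mk G fun _ : Unit => V)))
    (fun g V W h => hf (OpenFamily.mk_le_mk.2 (.of_smul g h)))
    (fun V W => by
      rw [← map_add, ← OpenFamily.mk_cond]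
      exact hf (OpenFamily.mk_le_mk.2 (.singleton_sup V W)))
    (fun V W h => by
      rw [← map_add, ← OpenFamily.mk_cond]
      exact hf (OpenFamily.mk_le_mk.2 (.pair_of_disjoint h)))

/-- Strict comparison by invariant measures gives `(n + 1) A ≺ n O` for each open set `A` compactly
contained in `V`: otherwise a state whose value at `A` is at least that at `O` would give an
invariant measure `μ` with `μ O ≤ μ V`. -/
lemma exists_mulSubequiv_of_measure_lt [CompactSpace X] [T2Space X] [MeasurableSpace X]
    [BorelSpace X] {V O A : Opens X} (hO : ∀ x : X, ∃ g : G, g • x ∈ O)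
    (hVO : ∀ μ ∈ invariantMeasures G X, μ V < μ O) (hAV : closure (A : Set X) ⊆ V) :
    ∃ n : ℕ, 0 < n ∧ MulSubequiv G (n + 1) (A : Set X) n (O : Set X) := by
  by_contra! hcon
  set u := OpenFamily.mk G fun _ : Unit => O with hu
  set a := OpenFamily.mk G fun _ : Unit => A with ha
  have hno : ∀ n : ℕ, ¬ (n + 1) • a ≤ n • u := by
    have hno' : ∀ n : ℕ, 0 < n → ¬ (n + 1) • a ≤ n • u := by
      intro n hn h
      rw [hu, ha, ← OpenFamily.mk_const, ← OpenFamily.mk_const, OpenFamily.mk_le_mk] at h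
      exact hcon n hn h.seqSubequiv
    intro n h
    rcases Nat.eq_zero_or_pos n with rfl | hn
    · have h1 : a ≤ 0 := by simpa using h
      refine hno' 1 one_pos ?_
      calc (1 + 1) • a = a + a := by rw [add_nsmul, one_nsmul]
        _ ≤ 0 + 0 := add_le_add h1 h1
        _ ≤ 1 • u := by rw [add_zero]; exact OpenFamily.zero_le _
    · exact hno' n hn h
  obtain ⟨f, hf, hfu, hfa⟩ := exists_state (u := u) (x := a) OpenFamily.zero_le
    (OpenFamily.exists_le_nsmul hO) hno
  let D := OpenContent.ofState f hf
  have hDO : D.toFun O = 1 := (congrArg Real.toNNReal hfu).trans Real.toNNReal_one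
  have hDA : 1 ≤ D.toFun A := Real.one_le_toNNReal.2 hfa
  have hDtop : D.toFun ⊤ ≠ 0 := (one_pos.trans_le (hDO.symm.trans_le (D.mono le_top))).ne'
  obtain ⟨μ, hμ, hle, hge⟩ := D.exists_invariantMeasure hDtop
  refine (hVO μ hμ).not_ge ?_
  have h1 : (D.toFun ⊤ : ENNReal) * μ O ≤ D.toFun ⊤ * μ V :=
    calc (D.toFun ⊤ : ENNReal) * μ O ≤ D.toFun O := hle O
      _ ≤ D.toFun A := by rw [hDO]; exact_mod_cast hDA
      _ ≤ D.toFun ⊤ * μ V := hge V A hAV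
  exact (ENNReal.mul_le_mul_iff_right (by simpa using hDtop) ENNReal.coe_ne_top).1 h1

end Comparison

end DynComparison

theorem theoremC {G X : Type*} [Group G] [Countable G] [Infinite G]
    [TopologicalSpace X] [CompactSpace X] [TopologicalSpace.MetrizableSpace X]
    [MeasurableSpace X] [BorelSpace X]
    [MulAction G X] [ContinuousConstSMul G X]
    (h : DynComparison.IsAmenable G ∨ MulAction.IsMinimal G X) :
    (∀ A B : Set X, IsOpen A → IsOpen B →
      (∀ μ ∈ DynComparison.invariantMeasures G X, 0 < μ B) →
      (∃ n : ℕ, 0 < n ∧ DynComparison.MulSubequiv G (n + 1) A n B) →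
      DynComparison.OpenSubequiv G A B) ↔
    DynComparison.HasDynamicalComparison G X := by
  constructor
  · intro hdiv V O hV hO hne hVO F hF hFV
    have hpos : ∀ μ ∈ DynComparison.invariantMeasures G X, 0 < μ O :=
      fun μ hμ => pos_of_gt (hVO μ hμ)
    have horbit : ∀ x : X, ∃ g : G, g • x ∈ O := by
      rcases h with hG | hmin
      · exact DynComparison.exists_smul_mem_of_isAmenable hG ⟨O, hO⟩ hpos
      · exact fun x => hO.exists_smul_mem G x hne
    obtain ⟨A, hA, hFA, hAV⟩ := normal_exists_closure_subset hF hV hFV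
    exact hdiv A O hA hO hpos
      (DynComparison.exists_mulSubequiv_of_measure_lt (V := ⟨V, hV⟩) (O := ⟨O, hO⟩) (A := ⟨A, hA⟩)
        horbit hVO hAV) F hF hFA
  · rintro hcomp A B hA hB hpos ⟨n, -, hn⟩
    exact DynComparison.openSubequiv_of_hasDynamicalComparison hcomp hA hB hpos hn
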